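/- **Theorem (Borkar–Meyn theorem for stochastic approximation with heavy-ball momentum).** Let $h:\mathbb{R}^d\to\mathbb{R}^d$, $\beta\in[0,1)$, and let $a(n)>0$, $n\ge 1$, be step sizes. Let $x_1$ be an $\mathbb{R}^d$-valued random vector and $(M_{n+1})_{n\ge1}$ a sequence of $\mathbb{R}^d$-valued random vectors on a common probability space, and consider the stochastic heavy-ball iteration $$x_{n+1}=x_n+a(n)\,m_n,\qquad m_n=\beta m_{n-1}+(1-\beta)\bigl(h(x_n)+M_{n+1}\bigr),\qquad n\ge1,\quad m_0=0 .$$ Write $h_c(x):=h(cx)/c$ for $c\ge1$, $x\in\mathbb{R}^d$. Suppose that 1. $h$ is Lipschitz continuous and satisfies at least one of the following two conditions: (a) there is a continuous $h_\infty:\mathbb{R}^d\to\mathbb{R}^d$ such that $h_c(x)\to h_\infty(x)$ for every $x$ as $c\to\infty$, and the ODE $\dot x(t)=h_\infty(x(t))$ has the origin as its unique globally asymptotically stable equilibrium; (b) there are a sequence $1\le c_n\nearrow\infty$ and a continuous $h_\infty:\mathbb{R}^d\to\mathbb{R}^d$ such that $h_{c_n}(x)\to h_\infty(x)$ for every $x$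 as $n\to\infty$, and the ODE $\dot x(t)=h_\infty(x(t))$ has the origin as its unique globally asymptotically stable equilibrium; 2. with $\mathcal F_n:=\sigma(x_1,M_2,\dots,M_n)$, the $M_{n+1}$ are square integrable, and for all $n\ge1$, almost surely, $\mathbb{E}[M_{n+1}\mid\mathcal F_n]=0$ and $\mathbb{E}[\|M_{n+1}\|^2\mid\mathcal F_n]\le K^2(1+\|x_n\|^2)$, for some constant $K>0$ not depending on $n$; 3. $a(n)=O(1/n)$ as $n\to\infty$. Then the iteration is stable almost surely, that is, $\sup_{n\ge1}\|x_n\|<\infty$ almost surely. -/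

import Mathlib

open MeasureTheory Filter Topology Asymptotics

/-- The curve `φ` is a solution on `[0, ∞)` of the autonomous ODE `x'(t) = f (x(t))`. -/
def IsODESolution {E : Type*} [NormedAddCommGroup E] [NormedSpace ℝ E]
    (f : E → E) (φ : ℝ → E) : Prop :=
  ∀ t : ℝ, 0 ≤ t → HasDerivWithinAt φ (f (φ t)) (Set.Ici 0) t

/-- The origin is the unique globally asymptotically stable equilibrium of `x'(t) = f (x(t))`:
it is the only equilibrium, it is Lyapunov stable, and every solution converges to it. -/
structure IsUniqueGASOrigin {E : Type*} [NormedAddCommGroup E] [NormedSpace ℝ E]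
    (f : E → E) : Prop where
  equilibrium : ∀ y : E, f y = 0 ↔ y = 0
  stable : ∀ ε : ℝ, 0 < ε → ∃ δ : ℝ, 0 < δ ∧
    ∀ φ : ℝ → E, IsODESolution f φ → ‖φ 0‖ < δ → ∀ t : ℝ, 0 ≤ t → ‖φ t‖ < ε
  attractive : ∀ φ : ℝ → E, IsODESolution f φ → Tendsto φ atTop (𝓝 0)

/-- The rescaled drift `h_c(x) = h(c x) / c`. -/
noncomputable def scaledDrift {E : Type*} [NormedAddCommGroup E] [NormedSpace ℝ E]
    (h : E → E) (c : ℝ) (x : E) : E :=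
  c⁻¹ • h (c • x)

/-- The Borkar–Meyn scaling condition: `h_c → h_∞` pointwise as `c → ∞`, with `h_∞` continuous and
`x' = h_∞(x)` having the origin as its unique globally asymptotically stable equilibrium. -/
def BorkarMeynCondition {E : Type*} [NormedAddCommGroup E] [NormedSpace ℝ E]
    (h : E → E) : Prop :=
  ∃ hInf : E → E, Continuous hInf ∧
    (∀ x : E, Tendsto (fun c : ℝ => scaledDrift h c x) atTop (𝓝 (hInf x))) ∧
    IsUniqueGASOrigin hInf

/-- The generalized Borkar–Meyn condition: the pointwise limit is only required
along one sequence `1 ≤ c_n ↗ ∞`. -/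
def GeneralizedBorkarMeynCondition {E : Type*} [NormedAddCommGroup E] [NormedSpace ℝ E]
    (h : E → E) : Prop :=
  ∃ c : ℕ → ℝ, (∀ n, 1 ≤ c n) ∧ Monotone c ∧ Tendsto c atTop atTop ∧
    ∃ hInf : E → E, Continuous hInf ∧
      (∀ x : E, Tendsto (fun n : ℕ => scaledDrift h (c n) x) atTop (𝓝 (hInf x))) ∧
      IsUniqueGASOrigin hInf

/-- The σ-algebra `F_n = σ(x₁, M₂, …, M_n)` (so `F_1 = σ(x₁)`). -/
@[reducible]
def historySigma {Ω E : Type*} [MeasurableSpace E]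
    (x₁ : Ω → E) (M : ℕ → Ω → E) (n : ℕ) : MeasurableSpace Ω :=
  MeasurableSpace.comap x₁ inferInstance ⊔
    ⨆ k ∈ Finset.Icc 2 n, MeasurableSpace.comap (M k) inferInstance

/-! A change of variables removes the momentum. With `q n = ∑ β^(k+1) a (n+k)`, the sequence `y n =
x n + q n • m (n-1)` satisfies `y (n+1) = y n + b n • (h (x n) + M (n+1))`, where `b n = (1-β)(a n +
q (n+1))`. This is an ordinary stochastic approximation, except that the drift is evaluated at `x
n`, and both `q n` and `b n` are `O(1/n)` (`exists_momentum_weights`).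

Divide by a large scale `s`, so that the drift is close to `hInf` on a fixed ball. The limiting flow
maps the unit ball into the ball of radius `1/4` after a uniform time `T`. An Euler scheme with
small errors therefore returns to the ball of radius `1/2`, is restarted there, and never leaves the
ball of radius `R` (`IsUniqueGASOrigin.exists_trapsEulerSchemes`, `heavyBall_norm_le_of_traps`).

Until `x` leaves the ball of radius `R * s`, the noise divided by `s` has second moments bounded
independently of `s`. Chebyshev's and Kolmogorov's inequalities, with `∑ 1/n² < ∞`, make the noise
harmless from some `n₀` on, with high probability and uniformly in `s`. Only then is `s` chosen,
large compared with the state at time `n₀`. One scale is enough, so convergence along a single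
sequence `c n` suffices. -/

/-! ### Global solutions of Lipschitz ODEs and uniform attraction. -/

section ODE

variable {E : Type*} [NormedAddCommGroup E] [NormedSpace ℝ E]

theorem IsODESolution.continuousOn {f : E → E} {φ : ℝ → E} (hφ : IsODESolution f φ) :
    ContinuousOn φ (Set.Ici 0) := fun t ht => (hφ t ht).continuousWithinAt

theorem IsODESolution.hasDerivWithinAt_Ici {f : E → E} {φ : ℝ → E} (hφ : IsODESolution f φ)
    {t : ℝ} (ht : 0 ≤ t) : HasDerivWithinAt φ (f (φ t)) (Set.Ici t) t :=
  (hφ t ht).mono (Set.Ici_subset_Ici.2 ht)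

/-- Time shifts of solutions of an autonomous ODE are solutions. -/
theorem IsODESolution.shift {f : E → E} {φ : ℝ → E} (hφ : IsODESolution f φ) {s : ℝ} (hs : 0 ≤ s) :
    IsODESolution f (fun t => φ (t + s)) := by
  intro t ht
  have h1 := hφ (t + s) (by positivity)
  have h2 : HasDerivWithinAt (fun u : ℝ => u + s) 1 (Set.Ici 0) t :=
    ((hasDerivAt_id t).add_const s).hasDerivWithinAt
  have h3 : Set.MapsTo (fun u : ℝ => u + s) (Set.Ici 0) (Set.Ici 0) := by
    intro u hu
    simp only [Set.mem_Ici] at hu ⊢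
    positivity
  simpa [Function.comp_def] using HasDerivWithinAt.scomp t h1 h2 h3

/-- Continuous dependence of solutions on the initial value. -/
theorem IsODESolution.dist_le {f : E → E} {L : NNReal} (hf : LipschitzWith L f) {φ ψ : ℝ → E}
    (hφ : IsODESolution f φ) (hψ : IsODESolution f ψ) {t : ℝ} (ht : 0 ≤ t) :
    dist (φ t) (ψ t) ≤ dist (φ 0) (ψ 0) * Real.exp (L * t) := by
  have := dist_le_of_trajectories_ODE (v := fun _ => f) (K := L) (a := 0) (b := t) (fun _ => hf)
    (hφ.continuousOn.mono Set.Icc_subset_Ici_self)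
    (fun u hu => hφ.hasDerivWithinAt_Ici hu.1)
    (hψ.continuousOn.mono Set.Icc_subset_Ici_self)
    (fun u hu => hψ.hasDerivWithinAt_Ici hu.1) le_rfl t ⟨ht, le_rfl⟩
  simpa using this

/-- An autonomous ODE with Lipschitz right-hand side is solvable on an interval whose length does
not depend on the initial value. -/
theorem exists_solution_Icc_of_lipschitz [CompleteSpace E] {f : E → E} {L : NNReal}
    (hf : LipschitzWith L f) : ∃ τ : ℝ, 0 < τ ∧ ∀ x : E, ∃ φ : ℝ → E, φ 0 = x ∧
      ∀ t ∈ Set.Icc 0 τ, HasDerivWithinAt φ (f (φ t)) (Set.Icc 0 τ) t := by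
  -- On the ball of radius `‖f x‖` about `x` the field is at most `(L + 1) * ‖f x‖`, so the Picard
  -- time is `1 / (L + 1)` for every `x`.
  refine ⟨1 / (L + 1), by positivity, fun x => ?_⟩
  set τ : ℝ := 1 / (L + 1) with hτ
  have hτ0 : 0 < τ := by positivity
  set A : NNReal := ‖f x‖₊ with hA
  have hb : ∀ y ∈ Metric.closedBall x A, ‖f y‖ ≤ ((L + 1) * A : NNReal) := by
    intro y hy
    have h1 := hf.dist_le_mul y x
    have h2 : ‖f y‖ ≤ ‖f x‖ + dist (f y) (f x) := by
      rw [dist_eq_norm]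
      simpa using norm_add_le (f x) (f y - f x)
    have h3 : L * dist y x ≤ L * A := mul_le_mul_of_nonneg_left hy L.2
    have h4 : (A : ℝ) = ‖f x‖ := rfl
    push_cast
    linarith
  have := IsPicardLindelof.of_time_independent (t₀ := (⟨0, le_rfl, hτ0.le⟩ : Set.Icc 0 τ))
    (x₀ := x) (a := A) (r := 0) (L := (L + 1) * A) (K := L) hb hf.lipschitzOnWith (by
      have : (((L + 1) * A : NNReal) : ℝ) * τ = A := by
        push_cast
        rw [hτ]
        field_simp
      push_cast at this
      simp [hτ0.le, this])
  exact this.exists_eq_forall_mem_Icc_hasDerivWithinAt₀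

/-- Global existence for an autonomous ODE with Lipschitz right-hand side. -/
theorem exists_isODESolution_of_lipschitz [CompleteSpace E] {f : E → E} {L : NNReal}
    (hf : LipschitzWith L f) (x : E) : ∃ φ : ℝ → E, φ 0 = x ∧ IsODESolution f φ := by
  obtain ⟨τ, hτ, hS⟩ := exists_solution_Icc_of_lipschitz hf
  choose S hS0 hS using hS
  -- Local solutions of equal length `τ` are glued; `p k` is the value at time `k * τ`.
  let p : ℕ → E := fun k => Nat.rec x (fun _ y => S y τ) k
  have hp : ∀ k, p (k + 1) = S (p k) τ := fun _ => rfl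
  let φ : ℝ → E := fun t => S (p ⌊t / τ⌋₊) (t - ⌊t / τ⌋₊ * τ)
  have hφ : ∀ k : ℕ, ∀ t ∈ Set.Icc (k * τ) ((k + 1) * τ), φ t = S (p k) (t - k * τ) := by
    intro k t ht
    have ht0 : 0 ≤ t := le_trans (by positivity) ht.1
    rcases eq_or_lt_of_le ht.2 with h | h
    · have hfl : ⌊t / τ⌋₊ = k + 1 := by
        rw [h, mul_div_cancel_right₀ _ hτ.ne']
        exact_mod_cast Nat.floor_natCast (R := ℝ) (k + 1)
      have e1 : t - ((k + 1 : ℕ) : ℝ) * τ = 0 := by rw [h]; push_cast; ring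
      have e2 : t - k * τ = τ := by rw [h]; ring
      simp only [φ]
      rw [hfl, e1, e2, hS0, hp]
    · have hfl : ⌊t / τ⌋₊ = k := by
        rw [Nat.floor_eq_iff (by positivity), le_div_iff₀ hτ, div_lt_iff₀ hτ]
        exact ⟨ht.1, h⟩
      simp only [φ]
      rw [hfl]
  have hd : ∀ k : ℕ, ∀ t ∈ Set.Icc (k * τ) ((k + 1) * τ),
      HasDerivWithinAt φ (f (φ t)) (Set.Icc (k * τ) ((k + 1) * τ)) t := by
    intro k t ht
    have hm : Set.MapsTo (fun u : ℝ => u - k * τ) (Set.Icc (k * τ) ((k + 1) * τ))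
        (Set.Icc 0 τ) := by
      intro u hu
      simp only [Set.mem_Icc] at hu ⊢
      constructor <;> linarith
    have h1 := hS (p k) (t - k * τ) (hm ht)
    have h2 : HasDerivWithinAt (fun u : ℝ => u - k * τ) 1 (Set.Icc (k * τ) ((k + 1) * τ)) t :=
      ((hasDerivAt_id t).sub_const (k * τ)).hasDerivWithinAt
    have h3 := HasDerivWithinAt.scomp t h1 h2 hm
    rw [one_smul, ← hφ k t ht] at h3
    exact h3.congr (fun u hu => hφ k u hu) (hφ k t ht)
  refine ⟨φ, ?_, fun t ht => ?_⟩
  · simp [φ, hS0, p]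
  have hlo : (⌊t / τ⌋₊ : ℝ) * τ ≤ t := (le_div_iff₀ hτ).1 (Nat.floor_le (by positivity))
  have hhi : t < (⌊t / τ⌋₊ + 1 : ℝ) * τ := (div_lt_iff₀ hτ).1 (Nat.lt_floor_add_one _)
  have hk := hd ⌊t / τ⌋₊ t ⟨hlo, hhi.le⟩
  -- At a positive grid point the derivatives from the two adjacent pieces are joined; at `0` only
  -- the right piece exists.
  rcases eq_or_lt_of_le hlo with h | h
  · rcases Nat.eq_zero_or_pos ⌊t / τ⌋₊ with h0 | h0
    · rw [h0] at hk h hhi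
      refine hk.mono_of_mem_nhdsWithin ?_
      simp only [Nat.cast_zero, zero_mul, zero_add, one_mul] at h hhi ⊢
      rw [← h]
      exact Icc_mem_nhdsGE hτ
    · obtain ⟨j, hj⟩ := Nat.exists_eq_add_of_lt h0
      rw [zero_add] at hj
      rw [hj] at hk h hhi
      push_cast at hk h hhi
      have hk' := hd j t ⟨by linarith, h.ge⟩
      refine ((hk'.union hk).hasDerivAt ?_).hasDerivWithinAt
      rw [Set.Icc_union_Icc_eq_Icc (by linarith) (by linarith)]
      exact Icc_mem_nhds (by linarith) hhi
  · exact (hk.hasDerivAt (Icc_mem_nhds h hhi)).hasDerivWithinAt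

/-- Global asymptotic stability is uniform over compact sets of initial values. -/
theorem IsUniqueGASOrigin.uniformly_attractive [CompleteSpace E] {f : E → E} {L : NNReal}
    (hf : LipschitzWith L f) (hG : IsUniqueGASOrigin f) {s : Set E} (hs : IsCompact s) {ε : ℝ}
    (hε : 0 < ε) : ∃ T : ℝ, 0 ≤ T ∧ ∀ φ : ℝ → E, IsODESolution f φ → φ 0 ∈ s →
      ∀ t, T ≤ t → ‖φ t‖ < ε := by
  obtain ⟨δ, hδ, hstab⟩ := hG.stable ε hε
  refine hs.induction_on (p := fun s => ∃ T : ℝ, 0 ≤ T ∧ ∀ φ : ℝ → E, IsODESolution f φ → φ 0 ∈ s →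
      ∀ t, T ≤ t → ‖φ t‖ < ε) ?_ ?_ ?_ ?_
  · exact ⟨0, le_rfl, fun φ _ h => absurd h (Set.notMem_empty _)⟩
  · rintro s t hst ⟨T, hT, h⟩
    exact ⟨T, hT, fun φ hφ h0 => h φ hφ (hst h0)⟩
  · rintro s t ⟨T, hT, h⟩ ⟨T', hT', h'⟩
    refine ⟨max T T', le_max_of_le_left hT, fun φ hφ h0 u hu => ?_⟩
    rcases h0 with h0 | h0
    · exact h φ hφ h0 u (le_of_max_le_left hu)
    · exact h' φ hφ h0 u (le_of_max_le_right hu)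
  · intro x _
    obtain ⟨ψ, hψ0, hψ⟩ := exists_isODESolution_of_lipschitz hf x
    obtain ⟨T, hT0, hT⟩ : ∃ T : ℝ, 0 ≤ T ∧ ‖ψ T‖ < δ / 2 := by
      have h1 := (hG.attractive ψ hψ).norm
      rw [norm_zero] at h1
      obtain ⟨T, h2, h3⟩ :=
        ((h1.eventually (gt_mem_nhds (half_pos hδ))).and (eventually_ge_atTop 0)).exists
      exact ⟨T, h3, h2⟩
    -- Errors grow by at most `exp (L * T)` up to time `T`, so all solutions from this ball are
    -- within `δ` of the origin then, and stability takes over.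
    set r : ℝ := δ / 2 / Real.exp (L * T) with hr
    have hr0 : 0 < r := by positivity
    refine ⟨Metric.ball x r, mem_nhdsWithin_of_mem_nhds (Metric.ball_mem_nhds x hr0), T, hT0, ?_⟩
    intro φ hφ h0 t ht
    have h1 := hφ.dist_le hf hψ hT0
    have h2 : dist (φ 0) (ψ 0) * Real.exp (L * T) < δ / 2 := by
      rw [hψ0]
      exact (lt_div_iff₀ (Real.exp_pos _)).1 h0
    have h3 : ‖φ T‖ < δ := by
      have : ‖φ T‖ ≤ dist (φ T) (ψ T) + ‖ψ T‖ := by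
        rw [dist_eq_norm]
        simpa using norm_add_le (φ T - ψ T) (ψ T)
      linarith
    have h4 := hstab _ (hφ.shift hT0) (by simpa using h3) (t - T) (by linarith)
    simpa using h4

/-- Solutions from the unit ball stay in a fixed ball, and in a small ball from a fixed time on. -/
theorem IsUniqueGASOrigin.exists_bound_and_time [ProperSpace E] {f : E → E} {L : NNReal}
    (hf : LipschitzWith L f) (hG : IsUniqueGASOrigin f) {ε : ℝ} (hε : 0 < ε) :
    ∃ R T : ℝ, 0 < R ∧ 0 ≤ T ∧ ∀ φ : ℝ → E, IsODESolution f φ → ‖φ 0‖ ≤ 1 →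
      (∀ t, 0 ≤ t → ‖φ t‖ ≤ R) ∧ ∀ t, T ≤ t → ‖φ t‖ ≤ ε := by
  obtain ⟨T, hT0, hT⟩ := hG.uniformly_attractive hf (isCompact_closedBall (0 : E) 1) hε
  refine ⟨Real.exp (L * T) + ε, T, by positivity, hT0, fun φ hφ h0 => ⟨fun t ht => ?_, fun t ht =>
    (hT φ hφ (by simpa using h0) t ht).le⟩⟩
  -- Before time `T` the bound comes from comparison with the zero solution, afterwards from
  -- attraction.
  have hzero : IsODESolution f (fun _ : ℝ => (0 : E)) := by
    intro t _
    simpa [(hG.equilibrium 0).2 rfl] using hasDerivWithinAt_const t (Set.Ici 0) (0 : E)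
  rcases le_total T t with h | h
  · have := hT φ hφ (by simpa using h0) t h
    have := Real.exp_pos (L * T)
    linarith
  · have h1 := hφ.dist_le hf hzero ht
    rw [dist_zero_right, dist_zero_right] at h1
    have h2 : Real.exp (L * t) ≤ Real.exp (L * T) :=
      Real.exp_le_exp.2 (mul_le_mul_of_nonneg_left h L.2)
    have h3 : ‖φ 0‖ * Real.exp (L * t) ≤ 1 * Real.exp (L * T) :=
      mul_le_mul h0 h2 (Real.exp_pos _).le zero_le_one
    linarith

end ODE

/-! ### Perturbed Euler schemes and trapping in a ball. -/

section Euler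

variable {E : Type*} [NormedAddCommGroup E] [NormedSpace ℝ E]

/-- Local error of one Euler step. -/
theorem IsODESolution.norm_euler_step_le {g : E → E} {L : NNReal} (hg : LipschitzWith L g)
    {φ : ℝ → E} (hφ : IsODESolution g φ) {B : ℝ} (hB : ∀ t, 0 ≤ t → ‖g (φ t)‖ ≤ B)
    {s b : ℝ} (hs : 0 ≤ s) (hb : 0 ≤ b) :
    ‖φ (s + b) - φ s - b • g (φ s)‖ ≤ L * B * b * b := by
  have hderiv : ∀ t ∈ Set.Icc s (s + b), HasDerivWithinAt φ (g (φ t)) (Set.Icc s (s + b)) t :=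
    fun t ht => (hφ t (hs.trans ht.1)).mono fun u hu => hs.trans hu.1
  have h1 : ∀ t ∈ Set.Icc s (s + b), ‖φ t - φ s‖ ≤ B * b := fun t ht =>
    (norm_image_sub_le_of_norm_deriv_le_segment' hderiv (fun u hu => hB u (hs.trans hu.1)) t
      ht).trans (mul_le_mul_of_nonneg_left (by linarith [ht.2])
        ((norm_nonneg _).trans (hB s hs)))
  -- Removing the tangent leaves a curve with derivative at most `L * B * b`.
  have h2 : ∀ t ∈ Set.Icc s (s + b), HasDerivWithinAt (fun t => φ t - t • g (φ s))
      (g (φ t) - g (φ s)) (Set.Icc s (s + b)) t := by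
    intro t ht
    have := ((hasDerivWithinAt_id t (Set.Icc s (s + b))).smul_const (g (φ s)))
    rw [one_smul] at this
    exact (hderiv t ht).sub this
  have h3 := norm_image_sub_le_of_norm_deriv_le_segment' h2 (C := L * (B * b)) (fun t ht => by
    have h4 := hg.dist_le_mul (φ t) (φ s)
    rw [dist_eq_norm, dist_eq_norm] at h4
    exact h4.trans (mul_le_mul_of_nonneg_left (h1 t ⟨ht.1, ht.2.le⟩) L.2)) (s + b)
    ⟨by linarith, le_rfl⟩
  calc ‖φ (s + b) - φ s - b • g (φ s)‖
      = ‖φ (s + b) - (s + b) • g (φ s) - (φ s - s • g (φ s))‖ := by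
        congr 1
        module
    _ ≤ L * (B * b) * (s + b - s) := h3
    _ = L * B * b * b := by ring

/-- Comparison of a perturbed Euler scheme with a solution of the limiting ODE. -/
theorem IsODESolution.norm_euler_sub_le {f g : E → E} {L : NNReal} (hg : LipschitzWith L g)
    {φ : ℝ → E} (hφ : IsODESolution g φ) {B κ : ℝ} (hκ : 0 ≤ κ)
    (hB : ∀ t, 0 ≤ t → ‖g (φ t)‖ ≤ B)
    {X Y W : ℕ → E} {b : ℕ → ℝ} {n₁ n : ℕ} (hn : n₁ ≤ n) (h0 : φ 0 = Y n₁)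
    (hb : ∀ k ∈ Finset.Ico n₁ n, 0 ≤ b k ∧ b k ≤ κ)
    (hY : ∀ k ∈ Finset.Ico n₁ n, Y (k + 1) = Y k + b k • (f (X k) + W k))
    (hfg : ∀ k ∈ Finset.Ico n₁ n, ‖f (X k) - g (X k)‖ ≤ κ)
    (hXY : ∀ k ∈ Finset.Ico n₁ n, ‖X k - Y k‖ ≤ κ)
    (hW : ∀ k ∈ Finset.Icc n₁ n, ‖∑ j ∈ Finset.Ico n₁ k, b j • W j‖ ≤ 2 * κ) :
    ‖Y n - φ (∑ j ∈ Finset.Ico n₁ n, b j)‖ ≤ 2 * κ + κ * (1 + 3 * L + L * B) *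
      (∑ j ∈ Finset.Ico n₁ n, b j) * Real.exp (L * ∑ j ∈ Finset.Ico n₁ n, b j) := by
  have hB0 : 0 ≤ B := (norm_nonneg _).trans (hB 0 le_rfl)
  -- The terms come from the drift gap, from `‖X - Y‖ ≤ κ` together with noise of size `2 * κ`, and
  -- from the local Euler error with step at most `κ`.
  set A : ℝ := κ * (1 + 3 * L + L * B) with hA
  have hA0 : 0 ≤ A := by positivity
  set S : ℕ → ℝ := fun k => ∑ j ∈ Finset.Ico n₁ k, b j with hS
  set N : ℕ → E := fun k => ∑ j ∈ Finset.Ico n₁ k, b j • W j with hN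
  -- Only the partial sums `N k` are small, not the individual perturbations, so they are subtracted
  -- before the discrete Gronwall argument.
  have key : ∀ k, n₁ ≤ k → k ≤ n →
      0 ≤ S k ∧ ‖Y k - N k - φ (S k)‖ ≤ A * S k * Real.exp (L * S k) := by
    intro k hk
    induction k, hk using Nat.le_induction with
    | base => simp [hS, hN, h0]
    | succ k hk ih =>
      intro hkn
      obtain ⟨hS0, hu⟩ := ih (by omega)
      have hkm : k ∈ Finset.Ico n₁ n := Finset.mem_Ico.2 ⟨hk, by omega⟩
      obtain ⟨hb0, hbκ⟩ := hb k hkm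
      have hS1 : S (k + 1) = S k + b k := Finset.sum_Ico_succ_top hk _
      have hN1 : N (k + 1) = N k + b k • W k := Finset.sum_Ico_succ_top hk _
      set u : ℝ := ‖Y k - N k - φ (S k)‖ with hu_def
      have hNk : ‖N k‖ ≤ 2 * κ := hW k (Finset.mem_Icc.2 ⟨hk, by omega⟩)
      have e1 := hφ.norm_euler_step_le hg hB hS0 hb0
      have e2 : ‖g (X k) - g (φ (S k))‖ ≤ L * (κ + u + 2 * κ) := by
        have h4 := hg.dist_le_mul (X k) (φ (S k))
        rw [dist_eq_norm, dist_eq_norm] at h4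
        refine h4.trans (mul_le_mul_of_nonneg_left ?_ L.2)
        have : X k - φ (S k) = (X k - Y k) + (Y k - N k - φ (S k)) + N k := by abel
        rw [this]
        exact (norm_add₃_le).trans (by linarith [hXY k hkm])
      have e3 : ‖b k • (f (X k) - g (φ (S k)))‖ ≤ b k * (κ + L * (κ + u + 2 * κ)) := by
        rw [norm_smul, Real.norm_of_nonneg hb0]
        refine mul_le_mul_of_nonneg_left ?_ hb0
        have : f (X k) - g (φ (S k)) = (f (X k) - g (X k)) + (g (X k) - g (φ (S k))) := by abel
        rw [this]
        exact (norm_add_le _ _).trans (add_le_add (hfg k hkm) e2)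
      have e4 : ‖Y (k + 1) - N (k + 1) - φ (S (k + 1))‖ ≤ (1 + L * b k) * u + b k * A := by
        have : Y (k + 1) - N (k + 1) - φ (S (k + 1)) =
            (Y k - N k - φ (S k)) + b k • (f (X k) - g (φ (S k))) +
              -(φ (S k + b k) - φ (S k) - b k • g (φ (S k))) := by
          rw [hY k hkm, hN1, hS1]
          module
        rw [this]
        refine (norm_add₃_le).trans ?_
        rw [norm_neg]
        have : L * B * b k * b k ≤ L * B * κ * b k := by gcongr
        rw [hA]
        linarith
      refine ⟨by rw [hS1]; positivity, e4.trans ?_⟩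
      have h5 : 1 + L * b k ≤ Real.exp (L * b k) := by
        linarith [Real.add_one_le_exp ((L : ℝ) * b k)]
      have h6 : (1 : ℝ) ≤ Real.exp (L * (S k + b k)) := Real.one_le_exp (by positivity)
      calc (1 + L * b k) * u + b k * A
          ≤ Real.exp (L * b k) * (A * S k * Real.exp (L * S k)) +
              b k * A * Real.exp (L * (S k + b k)) := by
            refine add_le_add (mul_le_mul h5 hu (norm_nonneg _) (Real.exp_pos _).le) ?_
            exact le_mul_of_one_le_right (by positivity) h6
        _ = A * S (k + 1) * Real.exp (L * S (k + 1)) := by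
            rw [hS1, mul_add (L : ℝ), Real.exp_add]
            ring
  have h1 := (key n hn le_rfl).2
  have h2 := hW n (Finset.mem_Icc.2 ⟨hn, le_rfl⟩)
  have : Y n - φ (S n) = N n + (Y n - N n - φ (S n)) := by abel
  change ‖Y n - φ (S n)‖ ≤ _
  rw [this]
  exact (norm_add_le _ _).trans (add_le_add h2 h1)

/-- A perturbed Euler scheme for a drift `κ`-close to `g` on the ball of radius `R` that starts in
the ball of radius `1 / 2` stays in the ball of radius `R`, provided the perturbations are at most
`κ` as long as the scheme has not left this ball. -/
def TrapsEulerSchemes (g : E → E) (R κ : ℝ) : Prop :=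
  ∀ (f : E → E) (X Y W : ℕ → E) (b : ℕ → ℝ) (n₀ : ℕ),
    (∀ z, ‖z‖ ≤ R → ‖f z - g z‖ ≤ κ) → (∀ n, n₀ ≤ n → 0 ≤ b n ∧ b n ≤ κ) →
    (∀ n, n₀ ≤ n → Y (n + 1) = Y n + b n • (f (X n) + W n)) → ‖Y n₀‖ ≤ 1 / 2 →
    (∀ n, n₀ ≤ n → (∀ k ∈ Finset.Ico n₀ n, ‖X k‖ ≤ R) →
      ‖X n - Y n‖ ≤ κ ∧ ‖∑ k ∈ Finset.Ico n₀ n, b k • W k‖ ≤ κ) →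
    ∀ n, n₀ ≤ n → ‖X n‖ ≤ R

/-- Deterministic core of the Borkar–Meyn theorem. -/
theorem IsUniqueGASOrigin.exists_trapsEulerSchemes [ProperSpace E] {hInf : E → E} {L : NNReal}
    (hL : LipschitzWith L hInf) (hG : IsUniqueGASOrigin hInf) :
    ∃ R κ : ℝ, 0 < R ∧ 0 < κ ∧ TrapsEulerSchemes hInf R κ := by
  obtain ⟨R₀, T, hR₀, hT0, hflow⟩ := hG.exists_bound_and_time hL (ε := 1 / 4) (by norm_num)
  -- `κ * D` bounds the comparison error over a time span at most `T + 1`; `κ` is chosen to make it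
  -- `1/4`.
  set D : ℝ := 2 + (1 + 3 * L + L * (L * R₀)) * (T + 1) * Real.exp (L * (T + 1)) with hD
  have hD2 : 2 ≤ D := by
    have : 0 ≤ (1 + 3 * L + L * (L * R₀)) * (T + 1) * Real.exp (L * (T + 1)) := by positivity
    linarith
  refine ⟨R₀ + 1, 1 / (4 * D), by positivity, by positivity, ?_⟩
  set κ : ℝ := 1 / (4 * D) with hκ
  have hκ0 : 0 < κ := by positivity
  have hκD : κ * D = 1 / 4 := by rw [hκ]; field_simp
  have hκ8 : κ ≤ 1 / 8 := by
    rw [hκ]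
    exact one_div_le_one_div_of_le (by norm_num) (by linarith)
  intro f X Y W b n₀ hf hb hY h0 hpert
  have compare : ∀ n₁ n, n₀ ≤ n₁ → n₁ ≤ n → ‖Y n₁‖ ≤ 1 / 2 →
      (∑ j ∈ Finset.Ico n₁ n, b j) ≤ T + 1 → (∀ k ∈ Finset.Ico n₀ n, ‖X k‖ ≤ R₀ + 1) →
      ‖Y n‖ ≤ R₀ + 1 / 4 ∧ (T ≤ ∑ j ∈ Finset.Ico n₁ n, b j → ‖Y n‖ ≤ 1 / 2) := by
    intro n₁ n hn₁ hn hY₁ hsum hX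
    obtain ⟨φ, hφ0, hφ⟩ := exists_isODESolution_of_lipschitz hL (Y n₁)
    obtain ⟨hφR, hφT⟩ := hflow φ hφ (by rw [hφ0]; linarith)
    have hB : ∀ t, 0 ≤ t → ‖hInf (φ t)‖ ≤ L * R₀ := by
      intro t ht
      have h4 := hL.dist_le_mul (φ t) 0
      rw [(hG.equilibrium 0).2 rfl, dist_zero_right, dist_zero_right] at h4
      exact h4.trans (mul_le_mul_of_nonneg_left (hφR t ht) L.2)
    have hsub : ∀ k, k ≤ n → ∀ j ∈ Finset.Ico n₀ k, ‖X j‖ ≤ R₀ + 1 := fun k hk j hj =>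
      hX j (Finset.Ico_subset_Ico_right hk hj)
    have hmem : ∀ k ∈ Finset.Ico n₁ n, n₀ ≤ k ∧ k < n := fun k hk => by
      rw [Finset.mem_Ico] at hk
      omega
    have hmain := hφ.norm_euler_sub_le hL (f := f) hκ0.le hB (X := X) (Y := Y) (W := W) (b := b) hn
      hφ0 (fun k hk => hb k (hmem k hk).1) (fun k hk => hY k (hmem k hk).1)
      (fun k hk => hf _ (hX k (Finset.mem_Ico.2 (hmem k hk))))
      (fun k hk => (hpert k (hmem k hk).1 (hsub k (hmem k hk).2.le)).1)
      -- Noise sums from the restart index `n₁` are differences of two sums from `n₀`, hence the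
      -- factor `2`.
      (fun k hk => by
        rw [Finset.mem_Icc] at hk
        have e1 := (hpert k (by omega) (hsub k hk.2)).2
        have e2 := (hpert n₁ hn₁ (hsub n₁ hn)).2
        rw [← Finset.sum_Ico_consecutive _ hn₁ hk.1] at e1
        have e3 := norm_sub_le ((∑ j ∈ Finset.Ico n₀ n₁, b j • W j) +
          ∑ j ∈ Finset.Ico n₁ k, b j • W j) (∑ j ∈ Finset.Ico n₀ n₁, b j • W j)
        rw [add_sub_cancel_left] at e3
        linarith)
    set S : ℝ := ∑ j ∈ Finset.Ico n₁ n, b j with hS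
    have hS0 : 0 ≤ S := Finset.sum_nonneg fun k hk => (hb k (hmem k hk).1).1
    have hsmall : ‖Y n - φ S‖ ≤ 1 / 4 := by
      refine hmain.trans (le_trans ?_ hκD.le)
      have h1 : S * Real.exp (L * S) ≤ (T + 1) * Real.exp (L * (T + 1)) := by gcongr
      have h2 : κ * (1 + 3 * L + L * (L * R₀)) * (S * Real.exp (L * S)) ≤
          κ * (1 + 3 * L + L * (L * R₀)) * ((T + 1) * Real.exp (L * (T + 1))) := by gcongr
      rw [hD]
      linarith
    have htri : ‖Y n‖ ≤ ‖Y n - φ S‖ + ‖φ S‖ := by simpa using norm_add_le (Y n - φ S) (φ S)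
    exact ⟨by linarith [hφR S hS0], fun h => by linarith [hφT S h]⟩
  have hXn : ∀ n, n₀ ≤ n → ‖Y n‖ ≤ R₀ + 1 / 4 → (∀ k ∈ Finset.Ico n₀ n, ‖X k‖ ≤ R₀ + 1) →
      ‖X n‖ ≤ R₀ + 1 := by
    intro n hn hYn hX
    have h1 := (hpert n hn hX).1
    have h2 : ‖X n‖ ≤ ‖X n - Y n‖ + ‖Y n‖ := by simpa using norm_add_le (X n - Y n) (Y n)
    linarith
  -- The induction carries a restart index `n₁` at which the scheme is in the half ball and since
  -- which at most time `T + 1` has elapsed.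
  have key : ∀ n, n₀ ≤ n → (∀ k ∈ Finset.Ico n₀ (n + 1), ‖X k‖ ≤ R₀ + 1) ∧
      ∃ n₁, n₀ ≤ n₁ ∧ n₁ ≤ n ∧ ‖Y n₁‖ ≤ 1 / 2 ∧ ∑ j ∈ Finset.Ico n₁ n, b j ≤ T + 1 := by
    intro n hn
    induction n, hn using Nat.le_induction with
    | base =>
      refine ⟨fun k hk => ?_, n₀, le_rfl, le_rfl, h0, by simp; positivity⟩
      obtain rfl : k = n₀ := by
        rw [Finset.mem_Ico] at hk
        omega
      exact hXn k le_rfl (compare k k le_rfl le_rfl h0 (by simp; positivity) (by simp)).1 (by simp)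
    | succ n hn ih =>
      obtain ⟨hX, n₁, hn₁, hn₁n, hY₁, hsum⟩ := ih
      have hX' : ∀ k ∈ Finset.Ico n₀ n, ‖X k‖ ≤ R₀ + 1 := fun k hk =>
        hX k (Finset.Ico_subset_Ico_right n.le_succ hk)
      obtain ⟨n₂, hn₂, hn₂n, hY₂, hsum₂⟩ : ∃ n₂, n₀ ≤ n₂ ∧ n₂ ≤ n + 1 ∧ ‖Y n₂‖ ≤ 1 / 2 ∧
          ∑ j ∈ Finset.Ico n₂ (n + 1), b j ≤ T + 1 := by
        have hbn := (hb n hn).2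
        -- Once time `T` has elapsed, `Y n` is back in the half ball and `n` becomes the restart
        -- index; otherwise one more step adds at most `κ ≤ 1`.
        rcases le_total T (∑ j ∈ Finset.Ico n₁ n, b j) with h | h
        · refine ⟨n, hn, n.le_succ, (compare n₁ n hn₁ hn₁n hY₁ hsum hX').2 h, ?_⟩
          rw [Nat.Ico_succ_singleton, Finset.sum_singleton]
          linarith
        · refine ⟨n₁, hn₁, by omega, hY₁, ?_⟩
          rw [Finset.sum_Ico_succ_top hn₁n]
          linarith
      refine ⟨fun k hk => ?_, n₂, hn₂, hn₂n, hY₂, hsum₂⟩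
      rw [Finset.mem_Ico] at hk
      rcases Nat.lt_or_ge k (n + 1) with h | h
      · exact hX k (Finset.mem_Ico.2 ⟨hk.1, h⟩)
      · obtain rfl : k = n + 1 := by omega
        exact hXn _ hk.1 (compare n₂ _ hn₂ hn₂n hY₂ hsum₂ hX).1 hX
  exact fun n hn => (key n hn).1 n (Finset.mem_Ico.2 ⟨hn, n.lt_succ_self⟩)

end Euler

/-! ### Kolmogorov's inequality in Hilbert space. -/

section MaximalInequality

variable {Ω E : Type*} [NormedAddCommGroup E] [InnerProductSpace ℝ E]

theorem integrable_inner_of_memLp_two {m0 : MeasurableSpace Ω} {μ : Measure Ω} {U ξ : Ω → E}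
    (hU : MemLp U 2 μ) (hξ : MemLp ξ 2 μ) : Integrable (fun ω => inner ℝ (U ω) (ξ ω)) μ := by
  refine (hU.norm.integrable_mul hξ.norm).mono' (hU.1.inner hξ.1) (Eventually.of_forall fun ω => ?_)
  exact norm_inner_le_norm _ _

/-- A martingale difference is orthogonal to square integrable variables of the past. -/
theorem integral_inner_eq_zero_of_condExp_eq_zero [CompleteSpace E] {m m0 : MeasurableSpace Ω} {μ : Measure Ω}
    [IsFiniteMeasure μ] (hm : m ≤ m0) {U ξ : Ω → E} (hU : StronglyMeasurable[m] U)
    (hU2 : MemLp U 2 μ) (hξ : MemLp ξ 2 μ) (h0 : μ[ξ | m] =ᵐ[μ] 0) :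
    ∫ ω, inner ℝ (U ω) (ξ ω) ∂μ = 0 := by
  have hint : Integrable (fun ω => innerSL ℝ (U ω) (ξ ω)) μ := integrable_inner_of_memLp_two hU2 hξ
  have h1 := condExp_bilin_of_stronglyMeasurable_left (innerSL ℝ) hU hint
    (hξ.integrable (by norm_num))
  have h2 := integral_condExp (μ := μ) hm (f := fun ω => innerSL ℝ (U ω) (ξ ω))
  change _ = ∫ ω, inner ℝ (U ω) (ξ ω) ∂μ at h2
  rw [← h2, integral_congr_ae h1, integral_congr_ae (g := fun _ => (0 : ℝ)), integral_zero]
  filter_upwards [h0] with ω hω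
  simp [hω]

/-- Kolmogorov's maximal inequality for Hilbert space valued martingale differences. -/
theorem measure_exists_norm_sum_gt_le [CompleteSpace E] {m0 : MeasurableSpace Ω} {μ : Measure Ω} [IsFiniteMeasure μ]
    (ℱ : Filtration ℕ m0) {ξ : ℕ → Ω → E} (hmeas : ∀ k, StronglyMeasurable[ℱ (k + 1)] (ξ k))
    (hL2 : ∀ k, MemLp (ξ k) 2 μ) (hmd : ∀ k, μ[ξ k | ℱ k] =ᵐ[μ] 0) {V r : ℝ} (hr : 0 < r)
    (hV : ∀ n, ∑ k ∈ Finset.range n, ∫ ω, ‖ξ k ω‖ ^ 2 ∂μ ≤ V) :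
    μ {ω | ∃ n, r < ‖∑ k ∈ Finset.range n, ξ k ω‖} ≤ ENNReal.ofReal (V / r ^ 2) := by
  set S : ℕ → Ω → E := fun n ω => ∑ k ∈ Finset.range n, ξ k ω with hS
  have hSmeas : ∀ n, StronglyMeasurable[ℱ n] (S n) := fun n =>
    Finset.stronglyMeasurable_fun_sum _ fun k hk =>
      (hmeas k).mono (ℱ.mono (Finset.mem_range.1 hk))
  set A : ℕ → Set Ω := fun n => {ω | ∀ j ≤ n, ‖S j ω‖ ≤ r} with hA
  have hAmeas : ∀ n, MeasurableSet[ℱ n] (A n) := by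
    intro n
    have : A n = ⋂ j ∈ Finset.range (n + 1), {ω | ‖S j ω‖ ≤ r} := by
      ext ω
      simp [hA]
    rw [this]
    refine Finset.measurableSet_biInter _ fun j hj => ?_
    have hj' : j ≤ n := Nat.lt_succ_iff.1 (Finset.mem_range.1 hj)
    exact ((hSmeas j).mono (ℱ.mono hj')).norm.measurable measurableSet_Iic
  -- Since `A n` is known at time `n`, this truncation keeps the martingale property, and it freezes
  -- the sum at its first value exceeding `r`.
  set ζ : ℕ → Ω → E := fun n => (A n).indicator (ξ n) with hζ
  set Z : ℕ → Ω → E := fun n ω => ∑ k ∈ Finset.range n, ζ k ω with hZ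
  have hζmeas : ∀ n, StronglyMeasurable[ℱ (n + 1)] (ζ n) := fun n =>
    (hmeas n).indicator (ℱ.mono n.le_succ _ (hAmeas n))
  have hZmeas : ∀ n, StronglyMeasurable[ℱ n] (Z n) := fun n =>
    Finset.stronglyMeasurable_fun_sum _ fun k hk =>
      (hζmeas k).mono (ℱ.mono (Finset.mem_range.1 hk))
  have hζL2 : ∀ n, MemLp (ζ n) 2 μ := fun n => (hL2 n).indicator (ℱ.le n _ (hAmeas n))
  have hZL2 : ∀ n, MemLp (Z n) 2 μ := fun n => memLp_finsetSum _ fun k _ => hζL2 k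
  have hζ0 : ∀ n, μ[ζ n | ℱ n] =ᵐ[μ] 0 := by
    intro n
    refine (condExp_indicator ((hL2 n).integrable (by norm_num)) (hAmeas n)).trans ?_
    filter_upwards [hmd n] with ω hω
    simp [Set.indicator_apply, hω]
  have hZint : ∀ n, ∫ ω, ‖Z n ω‖ ^ 2 ∂μ ≤ ∑ k ∈ Finset.range n, ∫ ω, ‖ξ k ω‖ ^ 2 ∂μ := by
    intro n
    induction n with
    | zero => simp [hZ]
    | succ n ih =>
      rw [Finset.sum_range_succ]
      have e1 : ∀ ω, ‖Z (n + 1) ω‖ ^ 2 =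
          ‖Z n ω‖ ^ 2 + 2 * inner ℝ (Z n ω) (ζ n ω) + ‖ζ n ω‖ ^ 2 := by
        intro ω
        simp only [hZ]
        rw [Finset.sum_range_succ, norm_add_sq_real]
      have i1 : Integrable (fun ω => ‖Z n ω‖ ^ 2) μ := (hZL2 n).integrable_norm_pow (by norm_num)
      have i2 : Integrable (fun ω => inner ℝ (Z n ω) (ζ n ω)) μ :=
        integrable_inner_of_memLp_two (hZL2 n) (hζL2 n)
      have i3 : Integrable (fun ω => ‖ζ n ω‖ ^ 2) μ := (hζL2 n).integrable_norm_pow (by norm_num)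
      have i4 : Integrable (fun ω => ‖ξ n ω‖ ^ 2) μ := (hL2 n).integrable_norm_pow (by norm_num)
      have h0 := integral_inner_eq_zero_of_condExp_eq_zero (ℱ.le n) (hZmeas n) (hZL2 n) (hζL2 n)
        (hζ0 n)
      have h1 : ∫ ω, ‖ζ n ω‖ ^ 2 ∂μ ≤ ∫ ω, ‖ξ n ω‖ ^ 2 ∂μ := by
        refine integral_mono i3 i4 fun ω => ?_
        simp only [hζ]
        gcongr
        exact norm_indicator_le_norm_self _ _
      simp_rw [e1]
      have i5 : Integrable (fun ω => ‖Z n ω‖ ^ 2 + 2 * inner ℝ (Z n ω) (ζ n ω)) μ :=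
        i1.add (i2.const_mul 2)
      rw [integral_add i5 i3, integral_add i1 (i2.const_mul 2), integral_const_mul, h0]
      linarith
  set B : ℕ → Set Ω := fun n => {ω | ∃ j ≤ n, r < ‖S j ω‖} with hB
  -- The frozen sum remembers any earlier exceedance, so Chebyshev's inequality for `Z n` alone
  -- controls the maximum.
  have hBZ : ∀ n, B n ⊆ {ω | r ^ 2 ≤ ‖Z n ω‖ ^ 2} := by
    rintro n ω ⟨j, hj, hrj⟩
    have hex : ∃ j, r < ‖S j ω‖ := ⟨j, hrj⟩
    classical
    set i := Nat.find hex with hi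
    have hin : i ≤ n := (Nat.find_min' hex hrj).trans hj
    have hir : r < ‖S i ω‖ := Nat.find_spec hex
    have hlt : ∀ k < i, ω ∈ A k := fun k hk l hl => not_lt.1 (Nat.find_min hex (hl.trans_lt hk))
    have hge : ∀ k, i ≤ k → ω ∉ A k := fun k hk hω => absurd hir (not_lt.2 (hω i hk))
    have hZS : Z n ω = S i ω := by
      simp only [hZ, hS]
      rw [← Finset.sum_range_add_sum_Ico _ hin, Finset.sum_eq_zero (s := Finset.Ico i n), add_zero]
      · exact Finset.sum_congr rfl fun k hk =>
          Set.indicator_of_mem (hlt k (Finset.mem_range.1 hk)) _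
      · exact fun k hk => Set.indicator_of_notMem (hge k (Finset.mem_Ico.1 hk).1) _
    simp only [Set.mem_ofPred_eq]
    rw [hZS]
    gcongr
  have hBle : ∀ n, μ (B n) ≤ ENNReal.ofReal (V / r ^ 2) := by
    intro n
    have i1 : Integrable (fun ω => ‖Z n ω‖ ^ 2) μ := (hZL2 n).integrable_norm_pow (by norm_num)
    have h1 := mul_meas_ge_le_integral_of_nonneg (μ := μ)
      (Eventually.of_forall fun ω => by positivity) i1 (r ^ 2)
    have h2 : μ.real {ω | r ^ 2 ≤ ‖Z n ω‖ ^ 2} ≤ V / r ^ 2 := by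
      rw [le_div_iff₀ (by positivity), mul_comm]
      exact h1.trans ((hZint n).trans (hV n))
    refine (measure_mono (hBZ n)).trans ?_
    rw [← ofReal_measureReal]
    exact ENNReal.ofReal_le_ofReal h2
  have hU : {ω | ∃ n, r < ‖∑ k ∈ Finset.range n, ξ k ω‖} = ⋃ n, B n := by
    ext ω
    simp only [Set.mem_ofPred_eq, Set.mem_iUnion, hB]
    exact ⟨fun ⟨n, hn⟩ => ⟨n, n, le_rfl, hn⟩, fun ⟨_, j, _, hj⟩ => ⟨j, hj⟩⟩
  have hmono : Monotone B := fun a b hab ω ⟨j, hj, h⟩ => ⟨j, hj.trans hab, h⟩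
  rw [hU, hmono.measure_iUnion]
  exact iSup_le hBle

end MaximalInequality

/-! ### Rescaled drifts and their limits. -/

section ScaledDrift

variable {E : Type*} [NormedAddCommGroup E] [NormedSpace ℝ E]

theorem scaledDrift_lipschitzWith {h : E → E} {L : NNReal} (hL : LipschitzWith L h) {c : ℝ}
    (hc : 0 < c) : LipschitzWith L (scaledDrift h c) := by
  refine LipschitzWith.of_dist_le_mul fun y z => ?_
  have h1 := hL.dist_le_mul (c • y) (c • z)
  rw [dist_smul₀, Real.norm_of_nonneg hc.le] at h1
  rw [scaledDrift, scaledDrift, dist_smul₀, Real.norm_of_nonneg (inv_nonneg.2 hc.le),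
    inv_mul_le_iff₀ hc]
  linarith

end ScaledDrift

section LipschitzLimit

variable {E : Type*} [NormedAddCommGroup E]

/-- Pointwise limits of `L`-Lipschitz maps are `L`-Lipschitz. -/
theorem lipschitzWith_of_tendsto {F : ℕ → E → E} {g : E → E} {L : NNReal}
    (hF : ∀ n, LipschitzWith L (F n)) (hlim : ∀ z, Tendsto (fun n => F n z) atTop (𝓝 (g z))) :
    LipschitzWith L g :=
  LipschitzWith.of_dist_le_mul fun y z =>
    le_of_tendsto ((hlim y).dist (hlim z)) (Eventually.of_forall fun n => (hF n).dist_le_mul y z)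

/-- Pointwise convergence of `L`-Lipschitz maps is uniform on compact sets. -/
theorem eventually_norm_sub_le_of_lipschitzWith {F : ℕ → E → E} {g : E → E} {L : NNReal}
    (hF : ∀ n, LipschitzWith L (F n)) (hlim : ∀ z, Tendsto (fun n => F n z) atTop (𝓝 (g z)))
    {s : Set E} (hs : IsCompact s) {κ : ℝ} (hκ : 0 < κ) :
    ∀ᶠ n in atTop, ∀ z ∈ s, ‖F n z - g z‖ ≤ κ := by
  have hg := lipschitzWith_of_tendsto hF hlim
  refine hs.induction_on (p := fun s => ∀ᶠ n in atTop, ∀ z ∈ s, ‖F n z - g z‖ ≤ κ) ?_ ?_ ?_ ?_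
  · simp
  · exact fun s t hst ht => ht.mono fun n hn z hz => hn z (hst hz)
  · intro s t hs ht
    filter_upwards [hs, ht] with n h1 h2 z hz
    exact hz.elim (h1 z) (h2 z)
  · intro y _
    -- The two Lipschitz errors cost `κ / 4` each, convergence at the centre `κ / 2`.
    have hr : 0 < κ / (4 * (L + 1)) := by positivity
    refine ⟨_, mem_nhdsWithin_of_mem_nhds (Metric.ball_mem_nhds y hr), ?_⟩
    have h1 := (tendsto_iff_dist_tendsto_zero.1 (hlim y)).eventually (gt_mem_nhds (half_pos hκ))
    filter_upwards [h1] with n hn z hz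
    have h2 : L * dist z y ≤ κ / 4 := by
      have h4 : dist z y * (4 * (L + 1)) < κ := (lt_div_iff₀ (by positivity)).1 hz
      nlinarith [dist_nonneg (x := z) (y := y)]
    have h3 := (hF n).dist_le_mul z y
    have h4 := hg.dist_le_mul y z
    rw [dist_comm y z] at h4
    rw [← dist_eq_norm]
    linarith [dist_triangle4 (F n z) (F n y) (g y) (g z)]

end LipschitzLimit

/-! ### Reduction of the heavy-ball iteration to an Euler scheme. -/

section Momentum

/-- Weights turning the heavy-ball iteration into a plain stochastic approximation. -/
theorem exists_momentum_weights {β C : ℝ} (hβ0 : 0 ≤ β) (hβ1 : β < 1) (hC : 0 ≤ C) {a : ℕ → ℝ}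
    {N : ℕ} (hN : 1 ≤ N) (ha : ∀ n, N ≤ n → 0 ≤ a n ∧ a n ≤ C / n) :
    ∃ q : ℕ → ℝ, ∀ n, N ≤ n →
      0 ≤ q n ∧ q n ≤ C / (1 - β) / n ∧ q n = β * (a n + q (n + 1)) := by
  have hgeo := summable_geometric_of_lt_one hβ0 hβ1
  have hterm : ∀ n, N ≤ n → ∀ k, 0 ≤ β ^ (k + 1) * a (n + k) ∧
      β ^ (k + 1) * a (n + k) ≤ β ^ k * (C / n) := by
    intro n hn k
    obtain ⟨h1, h2⟩ := ha (n + k) (by omega)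
    have hn0 : (0 : ℝ) < n := by exact_mod_cast hN.trans hn
    refine ⟨by positivity, mul_le_mul ?_ (h2.trans ?_) h1 (by positivity)⟩
    · exact pow_le_pow_of_le_one hβ0 hβ1.le k.le_succ
    · exact div_le_div_of_nonneg_left hC hn0 (by push_cast; linarith [k.cast_nonneg (α := ℝ)])
  have hsum : ∀ n, N ≤ n → Summable fun k => β ^ (k + 1) * a (n + k) := fun n hn =>
    Summable.of_nonneg_of_le (fun k => (hterm n hn k).1) (fun k => (hterm n hn k).2)
      (hgeo.mul_right _)
  -- This series is the recursion `q n = β * (a n + q (n + 1))` unrolled forward.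
  refine ⟨fun n => ∑' k, β ^ (k + 1) * a (n + k), fun n hn =>
    ⟨tsum_nonneg fun k => (hterm n hn k).1, ?_, ?_⟩⟩
  · refine ((hsum n hn).tsum_le_tsum (fun k => (hterm n hn k).2) (hgeo.mul_right _)).trans_eq ?_
    rw [tsum_mul_right, tsum_geometric_of_lt_one hβ0 hβ1]
    ring
  · change ∑' k, β ^ (k + 1) * a (n + k) = β * (a n + ∑' k, β ^ (k + 1) * a (n + 1 + k))
    rw [(hsum n hn).tsum_eq_zero_add, mul_add, ← tsum_mul_left]
    congr 1
    · simp
    · refine tsum_congr fun k => ?_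
      rw [show n + (k + 1) = n + 1 + k by omega]
      ring

variable {E : Type*} [NormedAddCommGroup E] [NormedSpace ℝ E]

/-- A heavy-ball trajectory stays in a ball of radius proportional to the scale `c`, as long as the
noise is small relative to this scale. -/
theorem heavyBall_norm_le_of_traps {h hInf : E → E} {R κ c β η : ℝ}
    (htrap : TrapsEulerSchemes hInf R κ) (hc : 0 < c) (hη : 0 ≤ η)
    (hclose : ∀ z, ‖z‖ ≤ R → ‖scaledDrift h c z - hInf z‖ ≤ κ) (hβ0 : 0 ≤ β) (hβ1 : β < 1)
    {a q b : ℕ → ℝ} {x m M : ℕ → E} {n₀ : ℕ}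
    (hm : ∀ n, n₀ ≤ n → m n = β • m (n - 1) + (1 - β) • (h (x n) + M (n + 1)))
    (hx : ∀ n, n₀ ≤ n → x (n + 1) = x n + a n • m n)
    (hq : ∀ n, n₀ ≤ n → q n = β * (a n + q (n + 1)))
    (hq' : ∀ n, n₀ ≤ n → 0 ≤ q n ∧ q n * (η * n) ≤ κ)
    (hb : ∀ n, b n = (1 - β) * (a n + q (n + 1)))
    (hb' : ∀ n, n₀ ≤ n → 0 ≤ b n ∧ b n ≤ κ)
    (hgrow : ∀ n, n₀ ≤ n → ∀ z, ‖z‖ ≤ R * c → ‖h z‖ ≤ η / 2 * c * n)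
    (h0 : ‖x n₀ + q n₀ • m (n₀ - 1)‖ ≤ c / 2) (hm0 : ‖m (n₀ - 1)‖ ≤ η * c * n₀)
    (hM : ∀ n, n₀ ≤ n → ‖x n‖ ≤ R * c → ‖M (n + 1)‖ ≤ η / 2 * c * n)
    (hS : ∀ n, n₀ ≤ n → (∀ k ∈ Finset.Ico n₀ n, ‖x k‖ ≤ R * c) →
      ‖∑ k ∈ Finset.Ico n₀ n, b k • M (k + 1)‖ ≤ κ * c) :
    ∀ n, n₀ ≤ n → ‖x n‖ ≤ R * c := by
  have hnorm : ∀ z : E, ‖c⁻¹ • z‖ = ‖z‖ / c := fun z => by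
    rw [norm_smul, Real.norm_of_nonneg (inv_nonneg.2 hc.le), inv_mul_eq_div]
  have hiff : ∀ z : E, ‖c⁻¹ • z‖ ≤ R ↔ ‖z‖ ≤ R * c := fun z => by
    rw [hnorm, div_le_iff₀ hc]
  -- The momentum is a convex combination of its predecessor and `h (x n) + M (n + 1)`, both at most
  -- `η * c * n`, so linear growth propagates.
  have hmb : ∀ n, n₀ ≤ n → (∀ k ∈ Finset.Ico n₀ n, ‖x k‖ ≤ R * c) →
      ‖m (n - 1)‖ ≤ η * c * n := by
    intro n hn
    induction n, hn using Nat.le_induction with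
    | base => exact fun _ => hm0
    | succ n hn ih =>
      intro hX
      have h1 := ih fun k hk => hX k (Finset.Ico_subset_Ico_right n.le_succ hk)
      have h2 := hX n (Finset.mem_Ico.2 ⟨hn, n.lt_succ_self⟩)
      have h3 := hgrow n hn _ h2
      have h4 := hM n hn h2
      rw [Nat.add_sub_cancel, hm n hn]
      have h5 : ‖h (x n) + M (n + 1)‖ ≤ η * c * n := (norm_add_le _ _).trans (by linarith)
      calc ‖β • m (n - 1) + (1 - β) • (h (x n) + M (n + 1))‖
          ≤ β * (η * c * n) + (1 - β) * (η * c * n) := by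
            refine (norm_add_le _ _).trans ?_
            rw [norm_smul, norm_smul, Real.norm_of_nonneg hβ0,
              Real.norm_of_nonneg (sub_nonneg.2 hβ1.le)]
            have := sub_nonneg.2 hβ1.le
            gcongr
        _ = η * c * n := by ring
        _ ≤ η * c * (n + 1 : ℕ) := by
            push_cast
            gcongr
            linarith
  intro n hn
  rw [← hiff]
  refine htrap (scaledDrift h c) (fun n => c⁻¹ • x n) (fun n => c⁻¹ • (x n + q n • m (n - 1)))
    (fun n => c⁻¹ • M (n + 1)) b n₀ hclose hb' ?_ ?_ ?_ n hn
  · intro n hn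
    simp only [scaledDrift, smul_inv_smul₀ hc.ne', Nat.add_sub_cancel]
    -- The recursion for `q` makes the coefficients of `m (n - 1)` cancel.
    rw [hx n hn, hb n, hq n hn, hm n hn]
    module
  · rw [hnorm, div_le_iff₀ hc]
    linarith
  · intro n hn hX
    simp only [hiff] at hX
    constructor
    -- The gap between the state and the shifted state is `q n • m (n - 1)`: the decay of `q`
    -- offsets the linear growth of `m`.
    · rw [← smul_sub, hnorm, div_le_iff₀ hc, sub_add_cancel_left, norm_neg, norm_smul,
        Real.norm_of_nonneg (hq' n hn).1]
      calc q n * ‖m (n - 1)‖ ≤ q n * (η * c * n) :=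
            mul_le_mul_of_nonneg_left (hmb n hn hX) (hq' n hn).1
        _ = q n * (η * n) * c := by ring
        _ ≤ κ * c := mul_le_mul_of_nonneg_right (hq' n hn).2 hc.le
    · have : ∑ k ∈ Finset.Ico n₀ n, b k • c⁻¹ • M (k + 1) =
          c⁻¹ • ∑ k ∈ Finset.Ico n₀ n, b k • M (k + 1) := by
        rw [Finset.smul_sum]
        exact Finset.sum_congr rfl fun k _ => smul_comm _ _ _
      rw [this, hnorm, div_le_iff₀ hc]
      exact hS n hn hX

end Momentum

/-! ### Probability bounds for noise localized before exit from a ball. -/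

section Noise

variable {Ω E : Type*} [NormedAddCommGroup E]

/-- Second moment of noise localized to a bounded set of states. -/
theorem integral_norm_indicator_sq_le {m m0 : MeasurableSpace Ω} {μ : Measure Ω}
    [IsProbabilityMeasure μ] (hm : m ≤ m0) {X ξ : Ω → E} (hX : StronglyMeasurable[m] X)
    (hξ : MemLp ξ 2 μ) {K ρ : ℝ}
    (hbound : μ[fun ω => ‖ξ ω‖ ^ 2 | m] ≤ᵐ[μ] fun ω => K ^ 2 * (1 + ‖X ω‖ ^ 2)) :
    ∫ ω, ‖({ω | ‖X ω‖ ≤ ρ}.indicator ξ) ω‖ ^ 2 ∂μ ≤ K ^ 2 * (1 + ρ ^ 2) := by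
  -- The localizing event belongs to the past, so the conditional bound can be integrated over it.
  have hG : MeasurableSet[m] {ω | ‖X ω‖ ≤ ρ} := hX.norm.measurable measurableSet_Iic
  have hint : Integrable (fun ω => ‖ξ ω‖ ^ 2) μ := hξ.integrable_norm_pow (by norm_num)
  have e1 : ∀ ω, ‖({ω | ‖X ω‖ ≤ ρ}.indicator ξ) ω‖ ^ 2 =
      {ω | ‖X ω‖ ≤ ρ}.indicator (fun ω => ‖ξ ω‖ ^ 2) ω := by
    intro ω
    by_cases hω : ω ∈ {ω | ‖X ω‖ ≤ ρ}
    · rw [Set.indicator_of_mem hω, Set.indicator_of_mem hω]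
    · rw [Set.indicator_of_notMem hω, Set.indicator_of_notMem hω]
      simp
  simp_rw [e1]
  rw [integral_indicator (hm _ hG), ← setIntegral_condExp hm hint hG]
  calc ∫ ω in {ω | ‖X ω‖ ≤ ρ}, (μ[fun ω => ‖ξ ω‖ ^ 2 | m]) ω ∂μ
      ≤ ∫ _ in {ω | ‖X ω‖ ≤ ρ}, K ^ 2 * (1 + ρ ^ 2) ∂μ := by
        refine setIntegral_mono_on_ae integrable_condExp.integrableOn
          (integrable_const _).integrableOn (hm _ hG) ?_
        filter_upwards [hbound] with ω hω hωG
        refine hω.trans ?_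
        have : ‖X ω‖ ≤ ρ := hωG
        gcongr
    _ ≤ K ^ 2 * (1 + ρ ^ 2) := by
        rw [setIntegral_const, smul_eq_mul]
        exact mul_le_of_le_one_left (by positivity) measureReal_le_one

/-- Probability that some noise term is large before the state leaves a ball. -/
theorem measure_exists_noise_gt_le {m0 : MeasurableSpace Ω} {μ : Measure Ω} [IsFiniteMeasure μ]
    {X ξ : ℕ → Ω → E} {V ρ : ℝ}
    (hL2 : ∀ k, MemLp ({ω | ‖X k ω‖ ≤ ρ}.indicator (ξ k)) 2 μ)
    (hV : ∀ k, ∫ ω, ‖({ω | ‖X k ω‖ ≤ ρ}.indicator (ξ k)) ω‖ ^ 2 ∂μ ≤ V)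
    {r : ℕ → ℝ} (hr : ∀ k, 0 < r k) (hsum : Summable fun k => 1 / r k ^ 2) :
    μ {ω | ∃ k, ‖X k ω‖ ≤ ρ ∧ r k < ‖ξ k ω‖} ≤ ENNReal.ofReal (V * ∑' k, 1 / r k ^ 2) := by
  have hV0 : 0 ≤ V := (integral_nonneg fun ω => by positivity).trans (hV 0)
  have hk : ∀ k, μ {ω | ‖X k ω‖ ≤ ρ ∧ r k < ‖ξ k ω‖} ≤ ENNReal.ofReal (V * (1 / r k ^ 2)) := by
    intro k
    have i1 : Integrable (fun ω => ‖({ω | ‖X k ω‖ ≤ ρ}.indicator (ξ k)) ω‖ ^ 2) μ :=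
      (hL2 k).integrable_norm_pow (by norm_num)
    have h1 := mul_meas_ge_le_integral_of_nonneg (μ := μ)
      (Eventually.of_forall fun ω => by positivity) i1 (r k ^ 2)
    have hrk := hr k
    have h2 : μ.real {ω | r k ^ 2 ≤ ‖({ω | ‖X k ω‖ ≤ ρ}.indicator (ξ k)) ω‖ ^ 2} ≤
        V * (1 / r k ^ 2) := by
      rw [mul_one_div, le_div_iff₀ (by positivity), mul_comm]
      exact h1.trans (hV k)
    refine (measure_mono (t := {ω | r k ^ 2 ≤ ‖({ω | ‖X k ω‖ ≤ ρ}.indicator (ξ k)) ω‖ ^ 2})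
      ?_).trans ?_
    · rintro ω ⟨h3, h4⟩
      rw [Set.mem_ofPred_eq, Set.indicator_of_mem (show ω ∈ {ω | ‖X k ω‖ ≤ ρ} from h3)]
      gcongr
    · rw [← ofReal_measureReal]
      exact ENNReal.ofReal_le_ofReal h2
  have hU : {ω | ∃ k, ‖X k ω‖ ≤ ρ ∧ r k < ‖ξ k ω‖} =
      ⋃ k, {ω | ‖X k ω‖ ≤ ρ ∧ r k < ‖ξ k ω‖} := by
    ext ω
    simp
  rw [hU, ← tsum_mul_left, ENNReal.ofReal_tsum_of_nonneg (fun k => by positivity)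
    (hsum.mul_left V)]
  exact (measure_iUnion_le _).trans (ENNReal.tsum_le_tsum hk)

/-- Probability that the accumulated noise is large before the state leaves a ball. -/
theorem measure_exists_noise_sum_gt_le [InnerProductSpace ℝ E] [CompleteSpace E]
    {m0 : MeasurableSpace Ω} {μ : Measure Ω} [IsFiniteMeasure μ] (ℱ : Filtration ℕ m0)
    {X ξ : ℕ → Ω → E} (hX : ∀ k, StronglyMeasurable[ℱ k] (X k))
    (hξ : ∀ k, StronglyMeasurable[ℱ (k + 1)] (ξ k)) (hL2 : ∀ k, MemLp (ξ k) 2 μ)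
    (hmd : ∀ k, μ[ξ k | ℱ k] =ᵐ[μ] 0) {V ρ : ℝ}
    (hV : ∀ k, ∫ ω, ‖({ω | ‖X k ω‖ ≤ ρ}.indicator (ξ k)) ω‖ ^ 2 ∂μ ≤ V)
    {b : ℕ → ℝ} {B : ℝ} (hb : ∀ n, ∑ k ∈ Finset.range n, b k ^ 2 ≤ B) {r : ℝ} (hr : 0 < r) :
    μ {ω | ∃ n, (∀ k < n, ‖X k ω‖ ≤ ρ) ∧ r < ‖∑ k ∈ Finset.range n, b k • ξ k ω‖} ≤
      ENNReal.ofReal (B * V / r ^ 2) := by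
  have hV0 : 0 ≤ V := (integral_nonneg fun ω => by positivity).trans (hV 0)
  set G : ℕ → Set Ω := fun k => {ω | ‖X k ω‖ ≤ ρ} with hG
  have hGm : ∀ k, MeasurableSet[ℱ k] (G k) := fun k => (hX k).norm.measurable measurableSet_Iic
  -- These increments have bounded second moments and agree with the true ones until the state
  -- leaves the ball.
  set ζ : ℕ → Ω → E := fun k => b k • (G k).indicator (ξ k) with hζ
  have h1 : ∀ k, StronglyMeasurable[ℱ (k + 1)] (ζ k) := fun k =>
    ((hξ k).indicator (ℱ.mono k.le_succ _ (hGm k))).const_smul (b k)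
  have h2 : ∀ k, MemLp (ζ k) 2 μ := fun k =>
    ((hL2 k).indicator (ℱ.le k _ (hGm k))).const_smul (b k)
  have h3 : ∀ k, μ[ζ k | ℱ k] =ᵐ[μ] 0 := by
    intro k
    refine (condExp_smul (b k) _ _).trans ?_
    filter_upwards [condExp_indicator ((hL2 k).integrable (by norm_num)) (hGm k), hmd k]
      with ω h4 h5
    simp [h4, Set.indicator_apply, h5]
  have h4 : ∀ n, ∑ k ∈ Finset.range n, ∫ ω, ‖ζ k ω‖ ^ 2 ∂μ ≤ B * V := by
    intro n
    calc ∑ k ∈ Finset.range n, ∫ ω, ‖ζ k ω‖ ^ 2 ∂μ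
        ≤ ∑ k ∈ Finset.range n, b k ^ 2 * V := by
          refine Finset.sum_le_sum fun k _ => ?_
          have : ∀ ω, ‖ζ k ω‖ ^ 2 = b k ^ 2 * ‖((G k).indicator (ξ k)) ω‖ ^ 2 := by
            intro ω
            simp only [hζ, Pi.smul_apply, norm_smul, mul_pow, Real.norm_eq_abs, sq_abs]
          simp_rw [this]
          rw [integral_const_mul]
          exact mul_le_mul_of_nonneg_left (hV k) (sq_nonneg _)
      _ = (∑ k ∈ Finset.range n, b k ^ 2) * V := by rw [Finset.sum_mul]
      _ ≤ B * V := mul_le_mul_of_nonneg_right (hb n) hV0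
  refine (measure_mono ?_).trans (measure_exists_norm_sum_gt_le ℱ h1 h2 h3 hr h4)
  rintro ω ⟨n, h5, h6⟩
  refine ⟨n, ?_⟩
  have : ∑ k ∈ Finset.range n, ζ k ω = ∑ k ∈ Finset.range n, b k • ξ k ω := by
    refine Finset.sum_congr rfl fun k hk => ?_
    simp only [hζ, Pi.smul_apply]
    rw [Set.indicator_of_mem (show ω ∈ G k from h5 k (Finset.mem_range.1 hk))]
  rwa [this]

/-- A real random variable is bounded with probability close to one. -/
theorem exists_measure_gt_le {m0 : MeasurableSpace Ω} {μ : Measure Ω} [IsFiniteMeasure μ]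
    {U : Ω → ℝ} (hU : Measurable U) {ε : ENNReal} (hε : 0 < ε) : ∃ A : ℝ, μ {ω | A < U ω} ≤ ε := by
  have h1 : Tendsto (fun n : ℕ => μ {ω | (n : ℝ) < U ω}) atTop
      (𝓝 (μ (⋂ n : ℕ, {ω | (n : ℝ) < U ω}))) :=
    tendsto_measure_iInter_atTop (fun n => (measurableSet_lt measurable_const hU).nullMeasurableSet)
      (fun i j hij ω (hω : (j : ℝ) < U ω) =>
        show (i : ℝ) < U ω from lt_of_le_of_lt (Nat.cast_le.2 hij) hω) ⟨0, measure_ne_top _ _⟩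
  have h2 : (⋂ n : ℕ, {ω | (n : ℝ) < U ω}) = ∅ := by
    refine Set.eq_empty_of_forall_notMem fun ω hω => ?_
    obtain ⟨n, hn⟩ := exists_nat_ge (U ω)
    exact absurd (Set.mem_iInter.1 hω n) (not_lt.2 hn)
  rw [h2, measure_empty] at h1
  obtain ⟨n, hn⟩ := (h1.eventually (gt_mem_nhds hε)).exists
  exact ⟨n, hn.le⟩

end Noise

/-! ### Measurability with respect to the history. -/

section History

variable {Ω E : Type*} [MeasurableSpace E]

theorem historySigma_mono (x₁ : Ω → E) (M : ℕ → Ω → E) : Monotone (historySigma x₁ M) :=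
  fun _ _ hij => sup_le_sup_left (biSup_mono fun k hk => by
    rw [Finset.mem_Icc] at hk ⊢
    omega) _

theorem historySigma_le {m0 : MeasurableSpace Ω} {x₁ : Ω → E} {M : ℕ → Ω → E}
    (hx : Measurable x₁) (hM : ∀ n : ℕ, 1 ≤ n → Measurable (M (n + 1))) (n : ℕ) :
    historySigma x₁ M n ≤ m0 := by
  refine sup_le hx.comap_le (iSup₂_le fun k hk => ?_)
  rw [Finset.mem_Icc] at hk
  obtain ⟨j, rfl⟩ := Nat.exists_eq_add_of_le' (show 1 ≤ k by omega)
  exact (hM j (by omega)).comap_le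

theorem measurable_initial_historySigma (x₁ : Ω → E) (M : ℕ → Ω → E) (n : ℕ) :
    Measurable[historySigma x₁ M n] x₁ :=
  (comap_measurable x₁).mono le_sup_left le_rfl

theorem measurable_noise_historySigma (x₁ : Ω → E) (M : ℕ → Ω → E) {k n : ℕ} (hk : 2 ≤ k)
    (hkn : k ≤ n) : Measurable[historySigma x₁ M n] (M k) :=
  (comap_measurable (M k)).mono (le_sup_of_le_right
    (le_iSup₂_of_le k (Finset.mem_Icc.2 ⟨hk, hkn⟩) le_rfl)) le_rfl

/-- The heavy-ball iterates and momenta are adapted. -/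
theorem heavyBall_adapted {E : Type*} [NormedAddCommGroup E] [NormedSpace ℝ E] [MeasurableSpace E]
    [BorelSpace E] [SecondCountableTopology E] {h : E → E} (hh : Continuous h) {β : ℝ} {a : ℕ → ℝ}
    {x m M : ℕ → Ω → E} (hm_zero : ∀ ω, m 0 ω = 0)
    (hm : ∀ n : ℕ, 1 ≤ n → ∀ ω,
      m n ω = β • m (n - 1) ω + (1 - β) • (h (x n ω) + M (n + 1) ω))
    (hx : ∀ n : ℕ, 1 ≤ n → ∀ ω, x (n + 1) ω = x n ω + a n • m n ω) (n : ℕ) (hn : 1 ≤ n) :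
    Measurable[historySigma (x 1) M n] (x n) ∧
      Measurable[historySigma (x 1) M n] (m (n - 1)) := by
  induction n, hn using Nat.le_induction with
  | base =>
    refine ⟨measurable_initial_historySigma _ _ _, ?_⟩
    have : m (1 - 1) = fun _ => 0 := funext hm_zero
    rw [this]
    exact measurable_const
  | succ n hn ih =>
    have hle := historySigma_mono (x 1) M n.le_succ
    have hxn := ih.1.mono hle le_rfl
    have hmn := ih.2.mono hle le_rfl
    have hMn := measurable_noise_historySigma (x 1) M (k := n + 1) (n := n + 1) (by omega) le_rfl
    have h1 : Measurable[historySigma (x 1) M (n + 1)] (m n) := by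
      rw [show m n = fun ω => β • m (n - 1) ω + (1 - β) • (h (x n ω) + M (n + 1) ω) from
        funext (hm n hn)]
      exact (hmn.const_smul β).add (((hh.measurable.comp hxn).add hMn).const_smul (1 - β))
    refine ⟨?_, h1⟩
    rw [show x (n + 1) = fun ω => x n ω + a n • m n ω from funext (hx n hn)]
    exact hxn.add (h1.const_smul (a n))

end History

/-! ### Choice of constants and conclusion. -/

theorem BorkarMeynCondition.generalized {E : Type*} [NormedAddCommGroup E] [NormedSpace ℝ E]
    {h : E → E} (hh : BorkarMeynCondition h) : GeneralizedBorkarMeynCondition h := by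
  obtain ⟨hInf, hcont, hlim, hG⟩ := hh
  have hc : Tendsto (fun n : ℕ => (n : ℝ) + 1) atTop atTop :=
    tendsto_atTop_add_const_right _ _ tendsto_natCast_atTop_atTop
  refine ⟨fun n => n + 1, fun n => by simp, fun i j hij => by simpa using hij, hc, hInf, hcont,
    fun z => (hlim z).comp hc, hG⟩

/-- Outside a set of small probability the heavy-ball iterates stay bounded. -/
theorem measure_heavyBall_unbounded_le {d : ℕ} {Ω : Type*} [MeasurableSpace Ω]
    (μ : Measure Ω) [IsProbabilityMeasure μ]
    (h : EuclideanSpace ℝ (Fin d) → EuclideanSpace ℝ (Fin d))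
    {L : NNReal} (hL : LipschitzWith L h) (hBM : GeneralizedBorkarMeynCondition h)
    (β : ℝ) (hβ : β ∈ Set.Ico (0 : ℝ) 1)
    (a : ℕ → ℝ) (ha_pos : ∀ n : ℕ, 1 ≤ n → 0 < a n)
    (ha : a =O[atTop] fun n : ℕ => 1 / (n : ℝ))
    (x m M : ℕ → Ω → EuclideanSpace ℝ (Fin d))
    (hx_meas : Measurable (x 1))
    (hM_meas : ∀ n : ℕ, 1 ≤ n → Measurable (M (n + 1)))
    (hM_sq : ∀ n : ℕ, 1 ≤ n → MemLp (M (n + 1)) 2 μ)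
    (hM_mds : ∀ n : ℕ, 1 ≤ n → μ[M (n + 1) | historySigma (x 1) M n] =ᵐ[μ] 0)
    {K : ℝ} (hM_bound : ∀ n : ℕ, 1 ≤ n →
      μ[fun ω => ‖M (n + 1) ω‖ ^ 2 | historySigma (x 1) M n]
        ≤ᵐ[μ] fun ω => K ^ 2 * (1 + ‖x n ω‖ ^ 2))
    (hm_zero : ∀ ω, m 0 ω = 0)
    (hm : ∀ n : ℕ, 1 ≤ n → ∀ ω,
      m n ω = β • m (n - 1) ω + (1 - β) • (h (x n ω) + M (n + 1) ω))
    (hx : ∀ n : ℕ, 1 ≤ n → ∀ ω, x (n + 1) ω = x n ω + a n • m n ω) {ε : ℝ} (hε : 0 < ε) :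
    μ {ω | ¬ ∃ C : ℝ, ∀ n : ℕ, 1 ≤ n → ‖x n ω‖ ≤ C} ≤ ENNReal.ofReal (3 * ε) := by
  obtain ⟨c, hc1, -, hctop, hInf, -, hlim, hG⟩ := hBM
  have hscaled : ∀ n, LipschitzWith L (scaledDrift h (c n)) := fun n =>
    scaledDrift_lipschitzWith hL (zero_lt_one.trans_le (hc1 n))
  obtain ⟨R, κ, hR, hκ, htrap⟩ :=
    hG.exists_trapsEulerSchemes (lipschitzWith_of_tendsto hscaled hlim)
  obtain ⟨hβ0, hβ1⟩ := hβ
  have hβ' : 0 < 1 - β := sub_pos.2 hβ1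
  obtain ⟨C, hC, hCa⟩ := ha.exists_pos
  obtain ⟨N₁, hN₁⟩ := eventually_atTop.1 hCa.bound
  set N : ℕ := max N₁ 1 with hN
  have haN : ∀ n, N ≤ n → 0 ≤ a n ∧ a n ≤ C / n := by
    intro n hn
    have h0 := ha_pos n ((le_max_right _ _).trans hn)
    refine ⟨h0.le, ?_⟩
    have h1 := hN₁ n ((le_max_left _ _).trans hn)
    rw [Real.norm_of_nonneg h0.le, Real.norm_of_nonneg (by positivity), mul_one_div] at h1
    exact h1
  obtain ⟨q, hq⟩ := exists_momentum_weights hβ0 hβ1 hC.le (le_max_right N₁ 1) haN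
  set b : ℕ → ℝ := fun n => (1 - β) * (a n + q (n + 1)) with hb
  have hbN : ∀ n, N ≤ n → 0 ≤ b n ∧ b n ≤ 2 * C / n := by
    intro n hn
    obtain ⟨h1, h2⟩ := haN n hn
    obtain ⟨h3, h4, -⟩ := hq (n + 1) (by omega)
    have hn0 : (0 : ℝ) < n := by exact_mod_cast (le_max_right N₁ 1).trans hn
    refine ⟨by positivity, ?_⟩
    have h5 : C / (1 - β) / (n + 1 : ℕ) ≤ C / (1 - β) / n :=
      div_le_div_of_nonneg_left (by positivity) hn0 (by push_cast; linarith)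
    calc (1 - β) * (a n + q (n + 1)) ≤ (1 - β) * (C / n + C / (1 - β) / n) := by
          gcongr
          exact h4.trans h5
      _ = (1 - β) * (C / n) + C / n := by field_simp
      _ ≤ 1 * (C / n) + C / n := by gcongr; linarith
      _ = 2 * C / n := by ring
  -- With `q n ≤ C / (1 - β) / n`, this gives exactly `q n * (η * n) ≤ κ`.
  set η : ℝ := κ * (1 - β) / C with hη
  have hη0 : 0 < η := by positivity
  set V : ℝ := K ^ 2 * (1 + R ^ 2) with hV
  have hV0 : 0 ≤ V := by positivity
  set τ : ℕ → ℝ := fun i => ∑' k : ℕ, 1 / ((k + i : ℕ) : ℝ) ^ 2 with hτ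
  have hτlim : Tendsto τ atTop (𝓝 0) := tendsto_sum_nat_add fun k : ℕ => 1 / (k : ℝ) ^ 2
  have hsummable : ∀ i : ℕ, Summable fun k : ℕ => 1 / ((k + i : ℕ) : ℝ) ^ 2 := fun i =>
    (summable_nat_add_iff (f := fun k : ℕ => 1 / (k : ℝ) ^ 2) i).2
      (Real.summable_one_div_nat_pow.2 one_lt_two)
  -- None of these conditions involves the scale `s`, which is therefore free to depend on `n₀`.
  obtain ⟨n₀, hn₀N, hn₀b, hn₀h, hn₀2, hn₀3⟩ : ∃ n₀ : ℕ, N ≤ n₀ ∧ 2 * C ≤ κ * n₀ ∧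
      ‖h 0‖ + L * R ≤ η / 2 * n₀ ∧ 4 * V / η ^ 2 * τ n₀ < ε ∧
      4 * C ^ 2 * V / κ ^ 2 * τ n₀ < ε := by
    have hcast : Tendsto (fun n : ℕ => (n : ℝ)) atTop atTop := tendsto_natCast_atTop_atTop
    have t1 := (hcast.const_mul_atTop hκ).eventually (eventually_ge_atTop (2 * C))
    have t2 := (hcast.const_mul_atTop (half_pos hη0)).eventually
      (eventually_ge_atTop (‖h 0‖ + L * R))
    have t3 := hτlim.const_mul (4 * V / η ^ 2)
    have t4 := hτlim.const_mul (4 * C ^ 2 * V / κ ^ 2)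
    rw [mul_zero] at t3 t4
    obtain ⟨n, h⟩ := ((eventually_ge_atTop N).and (t1.and (t2.and
      ((t3.eventually (gt_mem_nhds hε)).and (t4.eventually (gt_mem_nhds hε)))))).exists
    exact ⟨n, h⟩
  have hn₀1 : 1 ≤ n₀ := (le_max_right N₁ 1).trans hn₀N
  have hn₀pos : (0 : ℝ) < n₀ := by exact_mod_cast hn₀1
  have hle := historySigma_le hx_meas hM_meas
  have hadapt := heavyBall_adapted (M := M) hL.continuous hm_zero hm hx
  have hxm : ∀ n, 1 ≤ n → Measurable (x n) := fun n hn => (hadapt n hn).1.mono (hle n) le_rfl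
  have hmm : ∀ n, 1 ≤ n → Measurable (m (n - 1)) := fun n hn => (hadapt n hn).2.mono (hle n) le_rfl
  -- The single inequality `U ω ≤ s` yields both starting conditions of the trap, on the shifted
  -- state and on the momentum.
  set U : Ω → ℝ := fun ω =>
    2 * ‖x n₀ ω + q n₀ • m (n₀ - 1) ω‖ + ‖m (n₀ - 1) ω‖ / (η * n₀) with hU
  have hUm : Measurable U :=
    (((hxm n₀ hn₀1).add ((hmm n₀ hn₀1).const_smul (q n₀))).norm.const_mul 2).add
      ((hmm n₀ hn₀1).norm.div_const _)
  obtain ⟨A, hA⟩ := exists_measure_gt_le (μ := μ) hUm (ENNReal.ofReal_pos.2 hε)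
  obtain ⟨j, hjA, hjclose⟩ := ((hctop.eventually (eventually_ge_atTop A)).and
    (eventually_norm_sub_le_of_lipschitzWith hscaled hlim
      (isCompact_closedBall (0 : EuclideanSpace ℝ (Fin d)) R) hκ)).exists
  set s : ℝ := c j with hs
  have hs1 : 1 ≤ s := hc1 j
  have hs0 : 0 < s := zero_lt_one.trans_le hs1
  -- Time restarts at `n₀`: `x (k + n₀)` is known at time `k`, the noise `M (k + n₀ + 1)` at time `k
  -- + 1`.
  let ℱ : Filtration ℕ ‹MeasurableSpace Ω› :=
    { seq := fun k => historySigma (x 1) M (k + n₀)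
      mono' := fun i k hik => historySigma_mono _ _ (Nat.add_le_add_right hik n₀)
      le' := fun k => hle _ }
  have hXs : ∀ k, StronglyMeasurable[ℱ k] (x (k + n₀)) := fun k =>
    (hadapt (k + n₀) (by omega)).1.stronglyMeasurable
  have hξs : ∀ k, StronglyMeasurable[ℱ (k + 1)] (M (k + n₀ + 1)) := fun k =>
    (measurable_noise_historySigma (x 1) M (by omega) (by omega)).stronglyMeasurable
  have hξ2 : ∀ k, MemLp (M (k + n₀ + 1)) 2 μ := fun k => hM_sq (k + n₀) (by omega)
  have hξ2' : ∀ k, MemLp ({ω | ‖x (k + n₀) ω‖ ≤ R * s}.indicator (M (k + n₀ + 1))) 2 μ :=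
    fun k => (hξ2 k).indicator (ℱ.le k _ ((hXs k).norm.measurable measurableSet_Iic))
  have hVk : ∀ k, ∫ ω, ‖({ω | ‖x (k + n₀) ω‖ ≤ R * s}.indicator (M (k + n₀ + 1))) ω‖ ^ 2 ∂μ ≤
      V * s ^ 2 := by
    intro k
    refine (integral_norm_indicator_sq_le (ℱ.le k) (hXs k) (hξ2 k)
      (hM_bound (k + n₀) (by omega))).trans ?_
    rw [hV, mul_assoc]
    refine mul_le_mul_of_nonneg_left ?_ (sq_nonneg K)
    -- Since `s ≥ 1`, the constant `1` is absorbed: `1 + (R * s)² ≤ (1 + R²) * s²`.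
    nlinarith [one_le_pow₀ (n := 2) hs1]
  set E₁ : Set Ω := {ω | A < U ω} with hE₁
  set E₂ : Set Ω := {ω | ∃ k : ℕ, ‖x (k + n₀) ω‖ ≤ R * s ∧
    η / 2 * s * (k + n₀ : ℕ) < ‖M (k + n₀ + 1) ω‖} with hE₂
  set E₃ : Set Ω := {ω | ∃ n : ℕ, (∀ k < n, ‖x (k + n₀) ω‖ ≤ R * s) ∧
    κ * s < ‖∑ k ∈ Finset.range n, b (k + n₀) • M (k + n₀ + 1) ω‖} with hE₃
  have hμ₂ : μ E₂ ≤ ENNReal.ofReal ε := by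
    have e1 : ∀ k : ℕ, 1 / (η / 2 * s * (k + n₀ : ℕ)) ^ 2 =
        4 / (η ^ 2 * s ^ 2) * (1 / ((k + n₀ : ℕ) : ℝ) ^ 2) := by
      intro k
      have : (0 : ℝ) < (k + n₀ : ℕ) := by exact_mod_cast (by omega : 0 < k + n₀)
      field_simp
      norm_num
    refine (measure_exists_noise_gt_le (X := fun k => x (k + n₀)) (ξ := fun k => M (k + n₀ + 1))
      hξ2' hVk (r := fun k : ℕ => η / 2 * s * (k + n₀ : ℕ)) (fun k => ?_) ?_).trans
      (ENNReal.ofReal_le_ofReal ?_)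
    · have : (0 : ℝ) < (k + n₀ : ℕ) := by exact_mod_cast (by omega : 0 < k + n₀)
      positivity
    · simp_rw [e1]
      exact (hsummable n₀).mul_left _
    · simp_rw [e1]
      rw [tsum_mul_left]
      -- The variance factor `s ^ 2` cancels against the threshold, which is proportional to `s`.
      refine le_trans (le_of_eq ?_) hn₀2.le
      change V * s ^ 2 * (4 / (η ^ 2 * s ^ 2) * τ n₀) = _
      field_simp
  have hμ₃ : μ E₃ ≤ ENNReal.ofReal ε := by
    have hB : ∀ n, ∑ k ∈ Finset.range n, b (k + n₀) ^ 2 ≤ 4 * C ^ 2 * τ n₀ := by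
      intro n
      calc ∑ k ∈ Finset.range n, b (k + n₀) ^ 2
          ≤ ∑ k ∈ Finset.range n, 4 * C ^ 2 * (1 / ((k + n₀ : ℕ) : ℝ) ^ 2) := by
            refine Finset.sum_le_sum fun k _ => ?_
            obtain ⟨h1, h2⟩ := hbN (k + n₀) (by omega)
            refine (pow_le_pow_left₀ h1 h2 2).trans_eq ?_
            ring
        _ ≤ 4 * C ^ 2 * τ n₀ := by
            rw [← Finset.mul_sum]
            exact mul_le_mul_of_nonneg_left
              ((hsummable n₀).sum_le_tsum _ fun k _ => by positivity) (by positivity)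
    refine (measure_exists_noise_sum_gt_le ℱ hXs hξs hξ2 (fun k => hM_mds (k + n₀) (by omega)) hVk
      (b := fun k => b (k + n₀)) hB (r := κ * s) (by positivity)).trans
      (ENNReal.ofReal_le_ofReal ?_)
    refine le_trans (le_of_eq ?_) hn₀3.le
    field_simp
  have hsub : {ω | ¬ ∃ C : ℝ, ∀ n : ℕ, 1 ≤ n → ‖x n ω‖ ≤ C} ⊆ E₁ ∪ E₂ ∪ E₃ := by
    intro ω hω
    by_contra hcon
    simp only [Set.mem_union, not_or] at hcon
    obtain ⟨⟨h1, h2⟩, h3⟩ := hcon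
    simp only [hE₁, hE₂, hE₃, Set.mem_ofPred_eq, not_lt, not_exists, not_and] at h1 h2 h3
    have hUs : U ω ≤ s := h1.trans hjA
    have hbound := heavyBall_norm_le_of_traps (h := h) (β := β) (a := a) (q := q) (b := b) (n₀ := n₀)
      (x := fun n => x n ω) (m := fun n => m n ω) (M := fun n => M n ω) htrap hs0 hη0.le
      (fun z hz => hjclose z (by simpa using hz)) hβ0 hβ1
      (fun n hn => hm n (by omega) ω) (fun n hn => hx n (by omega) ω)
      (fun n hn => (hq n (by omega)).2.2) ?_ (fun n => rfl) ?_ ?_ ?_ ?_ ?_ ?_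
    -- The trap bounds the iterates from `n₀` on; the sum covers the finitely many earlier ones.
    · refine hω ⟨R * s + ∑ k ∈ Finset.range n₀, ‖x k ω‖, fun n _ => ?_⟩
      rcases lt_or_ge n n₀ with hn | hn
      · have := Finset.single_le_sum (f := fun k => ‖x k ω‖) (fun k _ => norm_nonneg _)
          (Finset.mem_range.2 hn)
        have : 0 ≤ R * s := by positivity
        linarith
      · have := hbound n hn
        have : 0 ≤ ∑ k ∈ Finset.range n₀, ‖x k ω‖ := Finset.sum_nonneg fun k _ => norm_nonneg _
        linarith
    · intro n hn
      have hn0 : (0 : ℝ) < n := by exact_mod_cast hn₀1.trans hn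
      obtain ⟨h4, h5, -⟩ := hq n (hn₀N.trans hn)
      refine ⟨h4, ?_⟩
      calc q n * (η * n) ≤ C / (1 - β) / n * (η * n) := by gcongr
        _ = κ := by rw [hη]; field_simp
    · intro n hn
      obtain ⟨h4, h5⟩ := hbN n (hn₀N.trans hn)
      have hn0 : (n₀ : ℝ) ≤ n := by exact_mod_cast hn
      refine ⟨h4, h5.trans ?_⟩
      rw [div_le_iff₀ (hn₀pos.trans_le hn0)]
      exact hn₀b.trans (by gcongr)
    · intro n hn z hz
      have hn0 : (n₀ : ℝ) ≤ n := by exact_mod_cast hn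
      have h4 := hL.dist_le_mul z 0
      rw [dist_zero_right, dist_eq_norm] at h4
      have h5 : ‖h z‖ ≤ ‖h z - h 0‖ + ‖h 0‖ := by simpa using norm_add_le (h z - h 0) (h 0)
      calc ‖h z‖ ≤ L * (R * s) + ‖h 0‖ * s := by
            have h6 : (L : ℝ) * ‖z‖ ≤ L * (R * s) := mul_le_mul_of_nonneg_left hz L.2
            have h7 : ‖h 0‖ ≤ ‖h 0‖ * s := le_mul_of_one_le_right (norm_nonneg _) hs1
            linarith
        _ = (‖h 0‖ + L * R) * s := by ring
        _ ≤ η / 2 * n * s := by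
            refine mul_le_mul_of_nonneg_right (hn₀h.trans ?_) hs0.le
            gcongr
        _ = η / 2 * s * n := by ring
    · have : 0 ≤ ‖m (n₀ - 1) ω‖ / (η * n₀) := by positivity
      simp only [hU] at hUs
      linarith
    · have : ‖m (n₀ - 1) ω‖ / (η * n₀) ≤ s := by
        have : 0 ≤ ‖x n₀ ω + q n₀ • m (n₀ - 1) ω‖ := norm_nonneg _
        simp only [hU] at hUs
        linarith
      rw [div_le_iff₀ (by positivity)] at this
      linarith
    · intro n hn hxn
      have := h2 (n - n₀)
      rw [Nat.sub_add_cancel hn] at this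
      exact this hxn
    · intro n hn hX
      have := h3 (n - n₀) fun k hk => hX (k + n₀) (Finset.mem_Ico.2 ⟨by omega, by omega⟩)
      rw [Finset.sum_Ico_eq_sum_range]
      simp_rw [add_comm n₀]
      exact this
  calc μ {ω | ¬ ∃ C : ℝ, ∀ n : ℕ, 1 ≤ n → ‖x n ω‖ ≤ C}
      ≤ μ E₁ + μ E₂ + μ E₃ := (measure_mono hsub).trans
        ((measure_union_le _ _).trans (add_le_add_left (measure_union_le _ _) _))
    _ ≤ ENNReal.ofReal ε + ENNReal.ofReal ε + ENNReal.ofReal ε :=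
        add_le_add (add_le_add hA hμ₂) hμ₃
    _ = ENNReal.ofReal (3 * ε) := by
        rw [← ENNReal.ofReal_add hε.le hε.le, ← ENNReal.ofReal_add (by positivity) hε.le]
        ring_nf

theorem mainTheorem8 {d : ℕ} {Ω : Type*} [MeasurableSpace Ω]
    (μ : Measure Ω) [IsProbabilityMeasure μ]
    (h : EuclideanSpace ℝ (Fin d) → EuclideanSpace ℝ (Fin d))
    (hLip : ∃ L : NNReal, LipschitzWith L h)
    (hBM : BorkarMeynCondition h ∨ GeneralizedBorkarMeynCondition h)
    (β : ℝ) (hβ : β ∈ Set.Ico (0 : ℝ) 1)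
    (a : ℕ → ℝ) (ha_pos : ∀ n : ℕ, 1 ≤ n → 0 < a n)
    (ha : a =O[atTop] fun n : ℕ => 1 / (n : ℝ))
    (x m M : ℕ → Ω → EuclideanSpace ℝ (Fin d))
    -- the random initial value and the noise
    (hx_meas : Measurable (x 1))
    (hM_meas : ∀ n : ℕ, 1 ≤ n → Measurable (M (n + 1)))
    (hM_sq : ∀ n : ℕ, 1 ≤ n → MemLp (M (n + 1)) 2 μ)
    (hM_mds : ∀ n : ℕ, 1 ≤ n → μ[M (n + 1) | historySigma (x 1) M n] =ᵐ[μ] 0)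
    (hM_bound : ∃ K : ℝ, 0 < K ∧ ∀ n : ℕ, 1 ≤ n →
      μ[fun ω => ‖M (n + 1) ω‖ ^ 2 | historySigma (x 1) M n]
        ≤ᵐ[μ] fun ω => K ^ 2 * (1 + ‖x n ω‖ ^ 2))
    -- the heavy-ball iteration
    (hm_zero : ∀ ω, m 0 ω = 0)
    (hm : ∀ n : ℕ, 1 ≤ n → ∀ ω,
      m n ω = β • m (n - 1) ω + (1 - β) • (h (x n ω) + M (n + 1) ω))
    (hx : ∀ n : ℕ, 1 ≤ n → ∀ ω, x (n + 1) ω = x n ω + a n • m n ω) :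
    ∀ᵐ ω ∂μ, ∃ C : ℝ, ∀ n : ℕ, 1 ≤ n → ‖x n ω‖ ≤ C := by
  obtain ⟨L, hL⟩ := hLip
  obtain ⟨K, -, hK⟩ := hM_bound
  have hBM' : GeneralizedBorkarMeynCondition h := hBM.elim (fun hh => hh.generalized) id
  rw [ae_iff]
  -- The unbounded event does not depend on `n₀` or `s`, so a bound by every `ε > 0` makes it null.
  refine le_antisymm (ENNReal.le_of_forall_pos_le_add fun ε hε _ => ?_) zero_le
  have hε' : (0 : ℝ) < ε / 3 := by positivity
  refine (measure_heavyBall_unbounded_le μ h hL hBM' β hβ a ha_pos ha x m M hx_meas hM_meas hM_sq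
    hM_mds hK hm_zero hm hx hε').trans ?_
  rw [mul_div_cancel₀ _ (by norm_num : (3 : ℝ) ≠ 0), ENNReal.ofReal_coe_nnreal, zero_add]
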